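/- **Setting.** Let $m\ge 1$ and let $C_m$ be the complete graph with vertices $v_1,\dots,v_m$. All graphs are finite, undirected and simple. For a subgraph $S$ of $C_m$ (with vertex set $V(S)\subseteq\{v_1,\dots,v_m\}$ and edge set $E(S)$), let $C_m\setminus S$ be the graph with vertex set $\{v_1,\dots,v_m\}$ and edge set $E(C_m)\setminus E(S)$. A set $A\subseteq V(S)$ is the inner hub of $S$ if $V(S_1)\cap V(S_2)=A$ for any two distinct maximal cliques $S_1,S_2$ of $S$; if $S$ is complete (so that $S$ is its only maximal clique), the inner hub is $A=V(S)$. The set $A$ may be empty. Write $N_G(v)$ for the set of vertices adjacent to $v$ in $G$. Let $X_1,\dots,X_m\subseteq\mathbb R^n$ be bounded open sets and let $\mu_i$ be a Borel probability measure on $X_i$, $i=1,\dots,m$. For a graph $G$ on $\{v_1,\dots,v_m\}$ put $$b(x_1,\dots,x_m)=\sum_{\{v_i,v_j\}\in E(G)}x_i\cdot x_j .$$ A Kantorovich solution is a Borel probability measure $\gamma$ on $X_1\times\dots\times X_m$ with marginals $\mu_1,\dots,\mu_m$ that maximizes $\int b\,d\gamma$ among all Borel probability measures on $X_1\times\dots\times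 X_m$ with these marginals. It is induced by a map if $\gamma=(\mathrm{Id},T_2,\dots,T_m)_\sharp\mu_1$ for some Borel maps $T_i:X_1\to X_i$, $i=2,\dots,m$. **Theorem 3.1.** Let $S$ be a subgraph of $C_m$ that has an inner hub $A$. Let $G=C_m\setminus S$ be connected, let $b$ be the surplus associated to $G$, and let $\mu_1$ be absolutely continuous with respect to Lebesgue measure $\mathcal L^n$. Assume that one of the following conditions holds: 1. $v_1\notin V(S)$; 2. there is $p$ with $v_p\in N_G(v_1)$ and $A\subseteq N_G(v_p)$ such that $\mu_p$ is absolutely continuous with respect to $\mathcal L^n$, and, if $S$ is not complete, $v_1\notin A$. Then every Kantorovich solution is induced by a map. -/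

import Mathlib

open MeasureTheory

namespace GraphTransport

/-- The extraction `C_m \ S` of a subgraph `S` (with its own vertex set) from the complete graph on
`m` vertices: all `m` vertices are kept, and the edges of `S` are removed. -/
def extraction {m : ℕ} (S : (⊤ : SimpleGraph (Fin m)).Subgraph) : SimpleGraph (Fin m) :=
  (⊤ : SimpleGraph (Fin m)).deleteEdges S.edgeSet

/-- `A` is the inner hub of the graph `H`: any two distinct maximal cliques of `H` meet exactly
in `A`. If `H` is complete, its only maximal clique is `H` itself, and the inner hub is the whole
vertex set. -/
def IsInnerHub {V : Type*} (H : SimpleGraph V) (A : Set V) : Prop :=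
  (∀ s t : Set V, Maximal H.IsClique s → Maximal H.IsClique t → s ≠ t → s ∩ t = A) ∧
    (H = ⊤ → A = Set.univ)

open scoped Classical in
/-- The surplus `∑_{{i,j} ∈ E(G)} x_i · x_j` associated to a graph `G`. -/
noncomputable def surplus {m n : ℕ} (G : SimpleGraph (Fin m))
    (x : Fin m → EuclideanSpace ℝ (Fin n)) : ℝ :=
  ∑ e ∈ G.edgeFinset,
    Sym2.lift ⟨fun i j => inner ℝ (x i) (x j), fun i j => real_inner_comm (x j) (x i)⟩ e

section Plans

variable {m n : ℕ} {X : Fin m → Set (EuclideanSpace ℝ (Fin n))}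

/-- `γ` is a Borel probability measure on `∏ X_i` whose marginals are the `μ_i`. -/
structure IsPlan (μ : ∀ i, Measure (X i)) (γ : Measure (∀ i, X i)) : Prop where
  prob : IsProbabilityMeasure γ
  marginal : ∀ i, γ.map (fun x => x i) = μ i

/-- `γ` maximizes `∫ b dγ` among all plans with marginals `μ_i`, where `b` is the surplus of `G`. -/
def IsKantorovichSolution (G : SimpleGraph (Fin m)) (μ : ∀ i, Measure (X i))
    (γ : Measure (∀ i, X i)) : Prop :=
  IsPlan μ γ ∧ ∀ γ' : Measure (∀ i, X i), IsPlan μ γ' →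
    ∫ x, surplus G (fun i => (x i : EuclideanSpace ℝ (Fin n))) ∂γ' ≤
      ∫ x, surplus G (fun i => (x i : EuclideanSpace ℝ (Fin n))) ∂γ

/-- `γ` is induced by a map: `γ = (Id, T_2, …, T_m)_♯ μ_1` for Borel maps `T_i : X_1 → X_i`
(the first vertex is the index `0`). -/
def IsInducedByMap [NeZero m] (μ : ∀ i, Measure (X i)) (γ : Measure (∀ i, X i)) : Prop :=
  ∃ T : ∀ i, X 0 → X i, (∀ i, Measurable (T i)) ∧ T 0 = id ∧
    γ = (μ 0).map (fun x i => T i x)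

/-- A measure on a subset of `ℝⁿ` is absolutely continuous with respect to Lebesgue measure. -/
def IsAbsCont {Y : Set (EuclideanSpace ℝ (Fin n))} (ν : Measure Y) : Prop :=
  (ν.map (fun y : Y => (y : EuclideanSpace ℝ (Fin n)))) ≪ volume

end Plans

end GraphTransport

namespace GraphTransport

section Subgradient

variable {E : Type*} [NormedAddCommGroup E] [InnerProductSpace ℝ E]

/-- Rockafellar's theorem for a bounded cyclically monotone set, with a Lipschitz potential. -/
theorem exists_lipschitz_subgradient (M : Set (E × E)) (R : NNReal) (hR : ∀ z ∈ M, ‖z.2‖ ≤ R)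
    (hcyc : ∀ (N : ℕ) (z : Fin (N + 1) → E × E), (∀ k, z k ∈ M) →
      ∑ k, inner ℝ (z k).2 ((z (k + 1)).1 - (z k).1) ≤ 0) :
    ∃ φ : E → ℝ, LipschitzWith R φ ∧
      ∀ z ∈ M, ∀ y, φ z.1 + inner ℝ z.2 (y - z.1) ≤ φ y := by
  rcases M.eq_empty_or_nonempty with rfl | ⟨z₀, hz₀⟩
  · exact ⟨fun _ => 0, LipschitzWith.const' 0, by simp⟩
  let ι := {q : (ℕ → E × E) × ℕ // q.1 0 = z₀ ∧ ∀ k, q.1 k ∈ M}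
  let S : ι → ℝ := fun q => ∑ k ∈ Finset.range q.1.2,
    inner ℝ (q.1.1 k).2 ((q.1.1 (k + 1)).1 - (q.1.1 k).1)
  let g : ι → E → ℝ := fun q y => S q + inner ℝ (q.1.1 q.1.2).2 (y - (q.1.1 q.1.2).1)
  have hι : Nonempty ι := ⟨⟨(fun _ => z₀, 0), rfl, fun _ => hz₀⟩⟩
  have hlip : ∀ q x y, g q x ≤ g q y + R * dist x y := by
    intro q x y
    have h1 : g q x - g q y = inner ℝ (q.1.1 q.1.2).2 (x - y) := by
      simp only [g, inner_sub_right]; ring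
    have h2 := real_inner_le_norm (q.1.1 q.1.2).2 (x - y)
    have h3 : ‖(q.1.1 q.1.2).2‖ * ‖x - y‖ ≤ R * ‖x - y‖ :=
      mul_le_mul_of_nonneg_right (hR _ (q.2.2 _)) (norm_nonneg _)
    rw [dist_eq_norm]
    linarith
  have hbase : ∀ q, g q z₀.1 ≤ 0 := by
    intro q
    have h := hcyc q.1.2 (fun k => q.1.1 k) (fun k => q.2.2 k)
    rw [Fin.sum_univ_castSucc] at h
    simp only [Fin.coeSucc_eq_succ, Fin.last_add_one, Fin.val_succ, Fin.val_castSucc, Fin.val_last,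
      Fin.val_zero, q.2.1] at h
    rw [Fin.sum_univ_eq_sum_range
      (fun k => inner ℝ (q.1.1 k).2 ((q.1.1 (k + 1)).1 - (q.1.1 k).1))] at h
    exact h
  have hbdd : ∀ y, BddAbove (Set.range fun q => g q y) := by
    intro y
    refine ⟨R * dist y z₀.1, ?_⟩
    rintro _ ⟨q, rfl⟩
    have := hlip q y z₀.1
    have := hbase q
    simp only
    linarith
  refine ⟨fun y => ⨆ q, g q y, LipschitzWith.of_le_add_mul _ fun x y => ?_, fun z hz y => ?_⟩
  · exact ciSup_le fun q => (hlip q x y).trans (add_le_add_left (le_ciSup (hbdd y) q) _)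
  · rw [← le_sub_iff_add_le]
    refine ciSup_le fun q => ?_
    rw [le_sub_iff_add_le]
    let q' : ι := ⟨(Function.update q.1.1 (q.1.2 + 1) z, q.1.2 + 1), by
        simp [Function.update_of_ne, q.2.1], fun k => by
        by_cases hk : k = q.1.2 + 1
        · subst hk; simpa using hz
        · simpa [Function.update_of_ne hk] using q.2.2 k⟩
    refine le_of_eq_of_le ?_ (le_ciSup (hbdd y) q')
    have hS : S q' = g q z.1 := by
      simp only [S, q', g, Finset.sum_range_succ]
      congr 1
      · refine Finset.sum_congr rfl fun k hk => ?_
        have := Finset.mem_range.1 hk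
        rw [Function.update_of_ne (by omega), Function.update_of_ne (by omega)]
      · rw [Function.update_self, Function.update_of_ne (by omega)]
    simp only [g] at hS ⊢
    rw [hS]
    simp [q']

theorem subgradient_unique {φ : E → ℝ} {x p q : E} (hφ : DifferentiableAt ℝ φ x)
    (hp : ∀ y, φ x + inner ℝ p (y - x) ≤ φ y) (hq : ∀ y, φ x + inner ℝ q (y - x) ≤ φ y) :
    p = q := by
  have key : ∀ r : E, (∀ y, φ x + inner ℝ r (y - x) ≤ φ y) → fderiv ℝ φ x = innerSL ℝ r := by
    intro r hr
    have hmin : IsLocalMin (fun y => φ y - innerSL ℝ r y) x := by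
      refine Filter.Eventually.of_forall fun y => ?_
      have := hr y
      simp only [innerSL_apply_apply, inner_sub_right] at this ⊢
      linarith
    have h0 := hmin.hasFDerivAt_eq_zero (hφ.hasFDerivAt.sub (innerSL ℝ r).hasFDerivAt)
    exact sub_eq_zero.1 h0
  refine ext_inner_right ℝ fun v => ?_
  have := congrArg (fun L => L v) ((key p hp).symm.trans (key q hq))
  simpa using this

/-- A bounded cyclically monotone set is single-valued outside a Lebesgue null set. -/
theorem exists_null_unique_of_cyclicallyMonotone [FiniteDimensional ℝ E] [MeasurableSpace E]
    [BorelSpace E] (ν : Measure E) [ν.IsAddHaarMeasure]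
    (M : Set (E × E)) (R : NNReal) (hR : ∀ z ∈ M, ‖z.2‖ ≤ R)
    (hcyc : ∀ (N : ℕ) (z : Fin (N + 1) → E × E), (∀ k, z k ∈ M) →
      ∑ k, inner ℝ (z k).2 ((z (k + 1)).1 - (z k).1) ≤ 0) :
    ∃ N : Set E, MeasurableSet N ∧ ν N = 0 ∧
      ∀ x ∉ N, ∀ p q, (x, p) ∈ M → (x, q) ∈ M → p = q := by
  obtain ⟨φ, hφ, hsub⟩ := exists_lipschitz_subgradient M R hR hcyc
  refine ⟨{x | DifferentiableAt ℝ φ x}ᶜ, (measurableSet_of_differentiableAt ℝ φ).compl,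
    hφ.ae_differentiableAt, fun x hx p q hp hq => ?_⟩
  exact subgradient_unique (not_not.1 hx) (hsub _ hp) (hsub _ hq)

end Subgradient

section CyclicalMonotonicity

variable {m : ℕ} {Y : Fin m → Type*} [∀ i, TopologicalSpace (Y i)]
  [∀ i, SecondCountableTopology (Y i)] [∀ i, MeasurableSpace (Y i)] [∀ i, BorelSpace (Y i)]

/-- Optimal multi-marginal plans are supported on cyclically monotone sets. -/
theorem sum_permute_le_of_mem_support (γ : Measure (∀ i, Y i)) [IsProbabilityMeasure γ]
    (b : (∀ i, Y i) → ℝ) (hb : Continuous b) (C : ℝ) (hC : ∀ x, |b x| ≤ C)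
    (hopt : ∀ γ' : Measure (∀ i, Y i), IsProbabilityMeasure γ' →
      (∀ i, γ'.map (fun x => x i) = γ.map (fun x => x i)) → ∫ x, b x ∂γ' ≤ ∫ x, b x ∂γ)
    {ι : Type*} [Fintype ι] [Nonempty ι] (x : ι → ∀ i, Y i) (hx : ∀ k, x k ∈ γ.support)
    (σ : Fin m → Equiv.Perm ι) :
    ∑ k, b (fun j => x (σ j k) j) ≤ ∑ k, b (x k) := by
  classical
  let Ω := ∀ i, Y i
  let η : Measure (ι → Ω) := Measure.pi fun _ => γ
  let P : ι → (ι → Ω) → Ω := fun k z j => z (σ j k) j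
  have hPc : ∀ k, Continuous (P k) := fun k => by fun_prop
  let g : (ι → Ω) → ℝ := fun z => ∑ k, b (P k z) - ∑ k, b (z k)
  have hg : Continuous g := by fun_prop
  let V : Set (ι → Ω) := {z | 0 < g z}
  have hV : IsOpen V := isOpen_lt continuous_const hg
  let F : ι → (ι → Ω) → Ω := fun k z => if z ∈ V then P k z else z k
  have hF : ∀ k, Measurable (F k) := fun k =>
    Measurable.ite hV.measurableSet (hPc k).measurable (measurable_pi_apply k)
  let N : ENNReal := (Fintype.card ι : ENNReal)
  have hN0 : N ≠ 0 := by simp [N]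
  have hNt : N ≠ ⊤ := by simp [N]
  let γ' : Measure Ω := N⁻¹ • ∑ k, η.map (F k)
  have hηF : ∀ k, IsProbabilityMeasure (η.map (F k)) := fun k =>
    Measure.isProbabilityMeasure_map (hF k).aemeasurable
  have hprob : IsProbabilityMeasure γ' := ⟨by
    simp only [γ', Measure.smul_apply, Measure.finsetSum_apply, measure_univ, Finset.sum_const,
      Finset.card_univ, smul_eq_mul, nsmul_eq_mul, mul_one]
    exact ENNReal.inv_mul_cancel hN0 hNt⟩
  have hmarg : ∀ i, γ'.map (fun x => x i) = γ.map (fun x => x i) := by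
    intro i
    ext s hs
    have hei : Measurable fun x : Ω => x i := measurable_pi_apply i
    have hs' : MeasurableSet ((fun x : Ω => x i) ⁻¹' s) := hei hs
    rw [Measure.map_apply hei hs, Measure.map_apply hei hs]
    simp only [γ', Measure.smul_apply, Measure.finsetSum_apply, smul_eq_mul]
    have hk : ∀ k, η.map (F k) ((fun x : Ω => x i) ⁻¹' s) =
        η ({z | z (σ i k) i ∈ s} ∩ V) + η ({z | z k i ∈ s} \ V) := by
      intro k
      rw [Measure.map_apply (hF k) hs', ← measure_inter_add_sdiff _ hV.measurableSet]
      congr 2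
      · ext z
        simp only [Set.mem_inter_iff, Set.mem_preimage, Set.mem_ofPred_eq]
        refine and_congr_left fun hz => ?_
        simp [F, hz, P]
      · ext z
        simp only [Set.mem_sdiff, Set.mem_preimage, Set.mem_ofPred_eq]
        refine and_congr_left fun hz => ?_
        simp [F, hz]
    have hre : ∑ k, η ({z | z (σ i k) i ∈ s} ∩ V) = ∑ k, η ({z | z k i ∈ s} ∩ V) :=
      Equiv.sum_comp (σ i) fun k => η ({z | z k i ∈ s} ∩ V)
    have hone : ∀ k, η {z | z k i ∈ s} = γ ((fun x : Ω => x i) ⁻¹' s) := fun k =>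
      (measurePreserving_eval (fun _ : ι => γ) k).measure_preimage hs'.nullMeasurableSet
    rw [Finset.sum_congr rfl fun k _ => hk k, Finset.sum_add_distrib, hre,
      ← Finset.sum_add_distrib,
      Finset.sum_congr rfl fun k _ => measure_inter_add_sdiff _ hV.measurableSet,
      Finset.sum_congr rfl fun k _ => hone k, Finset.sum_const, Finset.card_univ, nsmul_eq_mul,
      ← mul_assoc, ENNReal.inv_mul_cancel hN0 hNt, one_mul]
  have hint : ∀ (ν : Measure (ι → Ω)) [IsProbabilityMeasure ν] (f : (ι → Ω) → Ω),
      Measurable f → Integrable (fun z => b (f z)) ν := fun ν _ f hf =>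
    Integrable.of_bound (hb.measurable.comp hf).aestronglyMeasurable C
      (Filter.Eventually.of_forall fun z => hC _)
  have hintb : ∀ (ν : Measure Ω) [IsProbabilityMeasure ν], Integrable b ν := fun ν _ =>
    Integrable.of_bound hb.measurable.aestronglyMeasurable C (Filter.Eventually.of_forall hC)
  have h1 : ∫ x, b x ∂γ' = (Fintype.card ι : ℝ)⁻¹ * ∑ k, ∫ z, b (F k z) ∂η := by
    simp only [γ']
    rw [integral_smul_measure, integral_finsetSum_measure fun k _ => hintb _]
    simp only [smul_eq_mul, N, ENNReal.toReal_inv, ENNReal.toReal_natCast]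
    congr 1
    refine Finset.sum_congr rfl fun k _ => ?_
    exact integral_map (hF k).aemeasurable hb.measurable.aestronglyMeasurable
  have h2 : ∀ k, ∫ z, b (z k) ∂η = ∫ x, b x ∂γ := fun k => by
    rw [← (measurePreserving_eval (fun _ : ι => γ) k).map_eq]
    exact (integral_map (measurable_pi_apply k).aemeasurable
      hb.measurable.aestronglyMeasurable).symm
  have h3 : ∀ z, ∑ k, b (F k z) = ∑ k, b (z k) + max (g z) 0 := by
    intro z
    by_cases hz : z ∈ V
    · rw [max_eq_left (le_of_lt hz)]
      simp [F, hz, g]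
    · rw [max_eq_right (not_lt.1 hz)]
      simp [F, hz]
  have hgi : Integrable (fun z => max (g z) 0) η := by
    refine Integrable.congr (f := fun z => ∑ k, b (F k z) - ∑ k, b (z k)) ?_
      (Filter.Eventually.of_forall fun z => by simp [h3 z])
    exact (integrable_finsetSum _ fun k _ => hint η _ (hF k)).sub
      (integrable_finsetSum _ fun k _ => hint η _ (measurable_pi_apply k))
  have hcard : (0 : ℝ) < Fintype.card ι := by exact_mod_cast Fintype.card_pos
  have h4 : ∑ k, ∫ z, b (F k z) ∂η = Fintype.card ι * ∫ x, b x ∂γ + ∫ z, max (g z) 0 ∂η := by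
    rw [← integral_finsetSum _ fun k _ => hint η _ (hF k), integral_congr_ae
      (Filter.Eventually.of_forall h3), integral_add (integrable_finsetSum _ fun k _ =>
      hint η _ (measurable_pi_apply k)) hgi, integral_finsetSum _ fun k _ =>
      hint η _ (measurable_pi_apply k), Finset.sum_congr rfl fun k _ => h2 k]
    simp
  have h5 : ∫ z, max (g z) 0 ∂η = 0 := by
    refine le_antisymm ?_ (integral_nonneg fun z => le_max_right _ _)
    have := hopt γ' hprob hmarg
    rw [h1, h4, mul_add, ← mul_assoc, inv_mul_cancel₀ hcard.ne', one_mul] at this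
    have h6 : (Fintype.card ι : ℝ)⁻¹ * ∫ z, max (g z) 0 ∂η ≤ 0 := by linarith
    exact nonpos_of_mul_nonpos_right h6 (inv_pos.2 hcard)
  have h6 : η V = 0 := by
    have h7 := (integral_eq_zero_iff_of_nonneg (fun z => le_max_right _ _) hgi).1 h5
    refine measure_mono_null (fun z (hz : 0 < g z) => ?_) h7
    simp only [Set.mem_compl_iff, Set.mem_ofPred_eq, Pi.zero_apply, max_eq_right_iff, not_le]
    exact hz
  by_contra hlt
  have hxV : x ∈ V := sub_pos.2 (not_le.1 hlt)
  obtain ⟨I, u, hu, hsub⟩ := isOpen_pi_iff.1 hV x hxV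
  let U : ι → Set Ω := fun k => if k ∈ I then u k else Set.univ
  have hUpos : ∀ k, 0 < γ (U k) := by
    intro k
    refine (Measure.mem_support_iff_forall (x k)).1 (hx k) _ ?_
    by_cases hk : k ∈ I
    · simpa [U, hk] using (hu k hk).1.mem_nhds (hu k hk).2
    · simp [U, hk]
  have hUV : Set.univ.pi U ⊆ V := fun z hz => hsub fun k hk => by
    have := hz k trivial
    simpa [U, Finset.mem_coe.1 hk] using this
  have h8 : η (Set.univ.pi U) = 0 := measure_mono_null hUV h6
  rw [Measure.pi_pi] at h8
  exact (Finset.prod_ne_zero_iff.2 fun k _ => (hUpos k).ne') h8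

end CyclicalMonotonicity

section NeighborSum

variable {V E : Type*} [Fintype V] [NormedAddCommGroup E]

open scoped Classical in
/-- The sum of the entries of `x` over the neighbors of `v`. -/
noncomputable def neighborSum (G : SimpleGraph V) (x : V → E) (v : V) : E :=
  ∑ w, if G.Adj v w then x w else 0

theorem neighborSum_add (G : SimpleGraph V) (x y : V → E) (v : V) :
    neighborSum G (x + y) v = neighborSum G x v + neighborSum G y v := by
  classical
  simp only [neighborSum, ← Finset.sum_add_distrib]
  refine Finset.sum_congr rfl fun w _ => ?_
  split_ifs <;> simp

theorem neighborSum_neg (G : SimpleGraph V) (x : V → E) (v : V) :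
    neighborSum G (-x) v = -neighborSum G x v := by
  classical
  simp only [neighborSum, ← Finset.sum_neg_distrib]
  refine Finset.sum_congr rfl fun w _ => ?_
  split_ifs <;> simp

theorem neighborSum_sub (G : SimpleGraph V) (x y : V → E) (v : V) :
    neighborSum G (x - y) v = neighborSum G x v - neighborSum G y v := by
  rw [sub_eq_add_neg, neighborSum_add, neighborSum_neg, ← sub_eq_add_neg]

theorem neighborSum_single [DecidableEq V] (G : SimpleGraph V) (i v : V) (e : E)
    [Decidable (G.Adj v i)] :
    neighborSum G (Pi.single i e) v = if G.Adj v i then e else 0 := by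
  classical
  rw [neighborSum, Finset.sum_eq_single i]
  · simp
  · intro w _ hw; simp [Pi.single_eq_of_ne hw]
  · simp

theorem norm_neighborSum_le (G : SimpleGraph V) (x : V → E) (v : V) {R : ℝ}
    (hx : ∀ i, ‖x i‖ ≤ R) : ‖neighborSum G x v‖ ≤ Fintype.card V * R := by
  classical
  refine (norm_sum_le_of_le (n := fun _ => R) _ fun w _ => ?_).trans (by simp)
  split_ifs
  · exact hx w
  · simpa using (norm_nonneg _).trans (hx w)

theorem sum_inner_neighborSum_comm [InnerProductSpace ℝ E] (G : SimpleGraph V) (x y : V → E) :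
    ∑ v, inner ℝ (x v) (neighborSum G y v) = ∑ v, inner ℝ (y v) (neighborSum G x v) := by
  classical
  simp only [neighborSum, inner_sum]
  rw [Finset.sum_comm]
  refine Finset.sum_congr rfl fun v _ => Finset.sum_congr rfl fun w _ => ?_
  rw [G.adj_comm w v]
  split_ifs
  · rw [real_inner_comm]
  · simp

end NeighborSum

section Surplus

variable {m n : ℕ} (G : SimpleGraph (Fin m)) (x u : Fin m → EuclideanSpace ℝ (Fin n))

theorem two_mul_surplus :
    2 * surplus G x = ∑ v, inner ℝ (x v) (neighborSum G x v) := by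
  classical
  have h1 : surplus G x = ∑ p : Fin m × Fin m with G.Adj p.1 p.2 ∧ p.1 < p.2,
      inner ℝ (x p.1) (x p.2) := by
    symm
    refine Finset.sum_bij (fun p _ => s(p.1, p.2)) ?_ ?_ ?_ ?_
    · intro p hp
      simpa using (Finset.mem_filter.1 hp).2.1
    · intro p hp q hq hpq
      have hp' := (Finset.mem_filter.1 hp).2.2
      have hq' := (Finset.mem_filter.1 hq).2.2
      rcases Sym2.eq_iff.1 hpq with h | h
      · exact Prod.ext h.1 h.2
      · rw [h.1, h.2] at hp'
        exact absurd hp' hq'.asymm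
    · intro e he
      induction e with
      | _ a b =>
        have hab : G.Adj a b := by simpa using he
        rcases lt_or_gt_of_ne hab.ne with h | h
        · exact ⟨(a, b), by simp [hab, h], rfl⟩
        · exact ⟨(b, a), by simp [hab.symm, h], Sym2.eq_swap⟩
    · intro p _
      rfl
  have h2 : surplus G x = ∑ p : Fin m × Fin m with G.Adj p.1 p.2 ∧ p.2 < p.1,
      inner ℝ (x p.1) (x p.2) := by
    rw [h1]
    refine Finset.sum_bij (fun p _ => (p.2, p.1)) ?_ ?_ ?_ ?_
    · intro p hp
      have := (Finset.mem_filter.1 hp).2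
      simp [this.1.symm, this.2]
    · rintro ⟨a, b⟩ _ ⟨c, d⟩ _ h
      simp only [Prod.mk.injEq] at h
      simp [h.1, h.2]
    · rintro ⟨a, b⟩ hp
      have := (Finset.mem_filter.1 hp).2
      exact ⟨(b, a), by simpa using ⟨this.1.symm, this.2⟩, rfl⟩
    · intro p _
      exact real_inner_comm _ _
  have h3 : ∑ v, inner ℝ (x v) (neighborSum G x v) =
      ∑ p : Fin m × Fin m, if G.Adj p.1 p.2 then inner ℝ (x p.1) (x p.2) else 0 := by
    rw [Fintype.sum_prod_type]
    refine Finset.sum_congr rfl fun v _ => ?_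
    rw [neighborSum, inner_sum]
    refine Finset.sum_congr rfl fun w _ => ?_
    split_ifs <;> simp
  rw [h3, two_mul]
  nth_rewrite 1 [h1]
  rw [h2, Finset.sum_filter, Finset.sum_filter, ← Finset.sum_add_distrib]
  refine Finset.sum_congr rfl fun p _ => ?_
  by_cases hp : G.Adj p.1 p.2
  · rcases lt_or_gt_of_ne hp.ne with h | h <;> simp [hp, h, h.asymm]
  · simp [hp]

theorem surplus_add :
    surplus G (x + u) = surplus G x + ∑ v, inner ℝ (u v) (neighborSum G x v) + surplus G u := by
  have h1 := two_mul_surplus G (x + u)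
  have h2 := two_mul_surplus G x
  have h3 := two_mul_surplus G u
  have h4 := sum_inner_neighborSum_comm G x u
  simp only [Pi.add_apply, neighborSum_add, inner_add_left, inner_add_right,
    Finset.sum_add_distrib] at h1
  linarith

/-- The surplus after changing the entries over an independent set. -/
theorem surplus_add_of_independent (I : Finset (Fin m))
    (hI : ∀ v ∈ I, ∀ w ∈ I, ¬ G.Adj v w) (hu : ∀ v ∉ I, u v = 0) :
    surplus G (x + u) = surplus G x + ∑ v ∈ I, inner ℝ (u v) (neighborSum G x v) := by
  classical
  have h0 : surplus G u = 0 := by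
    have h := two_mul_surplus G u
    rw [Finset.sum_eq_zero] at h
    · linarith
    · intro v _
      by_cases hv : v ∈ I
      · have : neighborSum G u v = 0 := by
          refine Finset.sum_eq_zero fun w _ => ?_
          by_cases hw : w ∈ I
          · simp [hI v hv w hw]
          · simp [hu w hw]
        simp [this]
      · simp [hu v hv]
  rw [surplus_add, h0, add_zero]
  congr 1
  refine (Finset.sum_subset (Finset.subset_univ I) fun v _ hv => ?_).symm
  simp [hu v hv]

theorem surplus_update [DecidableEq (Fin m)] (i : Fin m) (e : EuclideanSpace ℝ (Fin n)) :
    surplus G (Function.update x i e) =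
      surplus G x + inner ℝ (e - x i) (neighborSum G x i) := by
  have hx : Function.update x i e = x + Pi.single i (e - x i) := by
    ext1 j
    by_cases hj : j = i
    · subst hj; simp
    · simp [hj]
  rw [hx, surplus_add_of_independent G x _ {i}]
  · simp
  · simp
  · intro v hv
    simp [Finset.notMem_singleton.1 hv]

theorem continuous_surplus :
    Continuous fun x : Fin m → EuclideanSpace ℝ (Fin n) => surplus G x := by
  classical
  have : (fun x : Fin m → EuclideanSpace ℝ (Fin n) => surplus G x) =
      fun x => (∑ v, inner ℝ (x v) (neighborSum G x v)) / 2 := by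
    funext x
    rw [← two_mul_surplus]; ring
  rw [this]
  unfold neighborSum
  refine Continuous.div_const (continuous_finsetSum _ fun v _ => Continuous.inner
    (continuous_apply v) (continuous_finsetSum _ fun w _ => ?_)) _
  split_ifs
  · exact continuous_apply w
  · exact continuous_const

theorem exists_abs_surplus_le (R : ℝ) :
    ∃ C, ∀ x : Fin m → EuclideanSpace ℝ (Fin n), (∀ i, ‖x i‖ ≤ R) → |surplus G x| ≤ C := by
  refine ⟨∑ _v : Fin m, R * (m * R), fun x hx => ?_⟩
  have h : |2 * surplus G x| ≤ ∑ _v : Fin m, R * (m * R) := by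
    rw [two_mul_surplus]
    refine Finset.abs_sum_le_sum_abs _ _ |>.trans (Finset.sum_le_sum fun v _ => ?_)
    refine (abs_real_inner_le_norm _ _).trans ?_
    have h1 := norm_neighborSum_le G x v hx
    rw [Fintype.card_fin] at h1
    exact mul_le_mul (hx v) h1 (norm_nonneg _) ((norm_nonneg _).trans (hx v))
  rw [abs_mul, abs_two] at h
  have := abs_nonneg (surplus G x)
  linarith

end Surplus

section Rigidity

variable {V E : Type*} [Fintype V] [NormedAddCommGroup E] [InnerProductSpace ℝ E]

theorem eq_zero_of_inner_neg_nonneg {e : E} (h : 0 ≤ inner ℝ e (-e)) : e = 0 := by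
  rw [inner_neg_right] at h
  have := real_inner_self_nonneg (x := e)
  exact inner_self_eq_zero.1 (by linarith : inner ℝ e e = 0)

/-- Let `G` be complete multipartite outside `A`, with the vertices of `A` joined exactly to the
universal vertices in `W`. A difference `d` of two points, vanishing together with its neighbor sum
at a vertex outside `A`, vanishes everywhere when it is monotone on independent sets and determined
by neighbor sums. -/
theorem eq_zero_of_monotone_of_determined (G : SimpleGraph V) (A W : Set V) (r : V) (d : V → E)
    (hW : ∀ w ∈ W, ∀ u, u ≠ w → G.Adj w u)
    (hA : ∀ a ∈ A, ∀ u, G.Adj a u ↔ u ∈ W)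
    (htwin : ∀ u ∉ A, ∀ v ∉ A, ¬ G.Adj u v → ∀ w, G.Adj u w ↔ G.Adj v w)
    (hr : r ∉ A) (hr0 : d r = 0) (hns : neighborSum G d r = 0)
    (hmono : ∀ I : Finset V, (∀ u ∈ I, ∀ v ∈ I, ¬ G.Adj u v) →
      0 ≤ ∑ i ∈ I, inner ℝ (d i) (neighborSum G d i))
    (hdet : ∀ v, neighborSum G d v = 0 → d v = 0) : d = 0 := by
  classical
  have hWA : ∀ a ∈ A, a ∉ W := fun a ha haW => G.irrefl ((hA a ha a).2 haW)
  have hnsW : ∀ w ∈ W, neighborSum G d w = ∑ u, d u - d w := by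
    intro w hw
    rw [eq_sub_iff_add_eq, ← Finset.sum_erase_add _ _ (Finset.mem_univ w), neighborSum,
      ← Finset.sum_erase_add _ _ (Finset.mem_univ w)]
    simp only [SimpleGraph.irrefl, if_false, add_zero]
    congr 1
    refine Finset.sum_congr rfl fun u hu => ?_
    rw [if_pos (hW w hw u (Finset.ne_of_mem_erase hu))]
  have hsplit : ∑ u, d u = (∑ u with u ∉ A, d u) + ∑ u with u ∈ A, d u := by
    rw [add_comm, Finset.sum_filter_add_sum_filter_not]
  let I : V → Finset V := fun v => {u | u ∉ A ∧ ¬ G.Adj v u}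
  have hnsI : ∀ v, v ∉ A → v ∉ W →
      neighborSum G d v = (∑ u with u ∉ A, d u) - ∑ u ∈ I v, d u := by
    intro v hvA hvW
    simp only [neighborSum, I, Finset.sum_filter, ← Finset.sum_sub_distrib]
    refine Finset.sum_congr rfl fun u _ => ?_
    by_cases hu : u ∈ A
    · have : ¬ G.Adj v u := fun h => hvW ((hA u hu v).1 h.symm)
      simp [hu, this]
    · by_cases h : G.Adj v u <;> simp [hu, h]
  have hconst : ∀ v, v ∉ A → ∀ u ∈ I v, neighborSum G d u = neighborSum G d v := by
    intro v hv u hu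
    obtain ⟨huA, huv⟩ := (Finset.mem_filter.1 hu).2
    simp only [neighborSum, htwin v hv u huA huv]
  have hIind : ∀ v, v ∉ A → ∀ u ∈ I v, ∀ w ∈ I v, ¬ G.Adj u w := by
    intro v hv u hu w hw huw
    obtain ⟨huA, huv⟩ := (Finset.mem_filter.1 hu).2
    exact (Finset.mem_filter.1 hw).2.2 ((htwin v hv u huA huv w).2 huw)
  have hImono : ∀ v, v ∉ A → 0 ≤ inner ℝ (∑ u ∈ I v, d u) (neighborSum G d v) := by
    intro v hv
    rw [sum_inner]
    refine (hmono (I v) (hIind v hv)).trans_eq (Finset.sum_congr rfl fun u hu => ?_)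
    rw [hconst v hv u hu]
  have hWzero : ∑ u, d u = 0 → ∀ w ∈ W, d w = 0 := by
    intro hD w hw
    have h := hmono {w} (by simp)
    rw [Finset.sum_singleton, hnsW w hw, hD, zero_sub] at h
    exact eq_zero_of_inner_neg_nonneg h
  have hE : ∑ u with u ∉ A, d u = 0 := by
    by_cases hrW : r ∈ W
    · have hD : ∑ u, d u = 0 := by
        have := hnsW r hrW
        rw [hns, hr0, sub_zero] at this
        exact this.symm
      have hw := hWzero hD
      have ha : ∀ a ∈ A, d a = 0 := fun a ha => hdet a <| Finset.sum_eq_zero fun w _ => by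
        by_cases h : G.Adj a w
        · simp [hw w ((hA a ha w).1 h)]
        · simp [h]
      rw [hsplit, Finset.sum_eq_zero (s := {u | u ∈ A}) (fun a h => ha a (by simpa using h)),
        add_zero] at hD
      exact hD
    · have h := hnsI r hr hrW
      rw [hns, Finset.sum_eq_zero (s := I r), sub_zero] at h
      · exact h.symm
      · intro u hu
        exact hdet u ((hconst r hr u hu).trans hns)
  have hB : ∀ v, v ∉ A → v ∉ W → d v = 0 := by
    intro v hvA hvW
    have h := hnsI v hvA hvW
    rw [hE, zero_sub] at h
    have h2 := hImono v hvA
    rw [h] at h2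
    refine hdet v ?_
    rw [h, eq_zero_of_inner_neg_nonneg h2, neg_zero]
  have hAz : ∀ a ∈ A, d a = 0 := by
    intro a ha
    refine hdet a (Eq.trans ?_ hE)
    rw [neighborSum, Finset.sum_filter]
    refine Finset.sum_congr rfl fun u _ => ?_
    by_cases huA : u ∈ A
    · simp [huA, hA a ha u, hWA u huA]
    · by_cases huW : u ∈ W
      · simp [huA, hA a ha u, huW]
      · simp [huA, hB u huA huW]
  have hD : ∑ u, d u = 0 := by
    rw [hsplit, hE, zero_add]
    exact Finset.sum_eq_zero fun a h => hAz a (by simpa using h)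
  funext v
  by_cases hvA : v ∈ A
  · exact hAz v hvA
  · by_cases hvW : v ∈ W
    · exact hWzero hD v hvW
    · exact hB v hvA hvW

end Rigidity

section Hub

variable {m : ℕ} (S : (⊤ : SimpleGraph (Fin m)).Subgraph)

theorem extraction_adj (u v : Fin m) :
    (extraction S).Adj u v ↔ u ≠ v ∧ ¬ S.Adj u v := by
  simp [extraction, SimpleGraph.deleteEdges_adj]

theorem extraction_adj_of_notMem {u v : Fin m} (hu : u ∉ S.verts) (h : v ≠ u) :
    (extraction S).Adj u v :=
  (extraction_adj S u v).2 ⟨h.symm, fun h' => hu (S.edge_vert h')⟩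

theorem exists_maximal_isClique {V : Type*} [Finite V] (H : SimpleGraph V) {s : Set V}
    (hs : H.IsClique s) : ∃ t, s ⊆ t ∧ Maximal H.IsClique t :=
  Finite.exists_le_maximal hs

/-- In a graph that is not complete, every vertex of the inner hub is adjacent to all others. -/
theorem adj_of_mem_innerHub {V : Type*} [Finite V] {H : SimpleGraph V} {A : Set V}
    (hA : IsInnerHub H A) (hH : H ≠ ⊤) {a u : V} (ha : a ∈ A) (hau : a ≠ u) : H.Adj a u := by
  obtain ⟨Q, hQ, hQmax⟩ := exists_maximal_isClique H (SimpleGraph.isClique_singleton (G := H) u)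
  have : ∃ Q', Maximal H.IsClique Q' ∧ Q ≠ Q' := by
    by_contra! hall
    refine hH (top_le_iff.1 fun v w hvw => ?_)
    have hmem : ∀ v, v ∈ Q := fun v => by
      obtain ⟨Q', hQ', hmax⟩ :=
        exists_maximal_isClique H (SimpleGraph.isClique_singleton (G := H) v)
      rw [hall Q' hmax]
      exact hQ' rfl
    exact hQmax.prop (hmem v) (hmem w) hvw
  obtain ⟨Q', hQ'max, hne⟩ := this
  have haQ : a ∈ Q := by
    have := hA.1 Q Q' hQmax hQ'max hne
    exact (this ▸ ha : a ∈ Q ∩ Q').1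
  exact hQmax.prop haQ (hQ rfl) hau

/-- Outside the inner hub, adjacency is transitive. -/
theorem adj_trans_of_notMem_innerHub {V : Type*} [Finite V] {H : SimpleGraph V} {A : Set V}
    (hA : IsInnerHub H A) {u v w : V} (hu : u ∉ A) (huv : H.Adj u v) (huw : H.Adj u w)
    (hvw : v ≠ w) : H.Adj v w := by
  obtain ⟨Q, hQ, hQmax⟩ := exists_maximal_isClique H
    (SimpleGraph.isClique_pair.2 fun _ => huv)
  obtain ⟨Q', hQ', hQ'max⟩ := exists_maximal_isClique H
    (SimpleGraph.isClique_pair.2 fun _ => huw)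
  by_cases hne : Q = Q'
  · subst hne
    exact hQmax.prop (hQ (by simp)) (hQ' (by simp)) hvw
  · exact absurd (hA.1 Q Q' hQmax hQ'max hne ▸ ⟨hQ (by simp), hQ' (by simp)⟩ : u ∈ A) hu

variable {S} {A : Set S.verts}

theorem extraction_adj_innerHub_iff (hA : IsInnerHub S.coe A) (hS : S.coe ≠ ⊤) {a : Fin m}
    (ha : a ∈ Subtype.val '' A) (u : Fin m) : (extraction S).Adj a u ↔ u ∉ S.verts := by
  obtain ⟨a, ha, rfl⟩ := ha
  rw [extraction_adj]
  constructor
  · rintro ⟨hne, hnot⟩ hu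
    exact hnot (adj_of_mem_innerHub hA hS ha (u := ⟨u, hu⟩) fun h => hne (congrArg Subtype.val h))
  · intro hu
    exact ⟨fun h => hu (h ▸ a.2), fun h => hu (S.edge_vert h.symm)⟩

theorem extraction_twin (hA : IsInnerHub S.coe A) {u v : Fin m}
    (hu : u ∉ Subtype.val '' A) (hv : v ∉ Subtype.val '' A) (h : ¬ (extraction S).Adj u v)
    (w : Fin m) : (extraction S).Adj u w ↔ (extraction S).Adj v w := by
  have key : ∀ u v : Fin m, u ∉ Subtype.val '' A → S.Adj u v →
      (extraction S).Adj v w → (extraction S).Adj u w := by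
    intro u v hu huv hvw
    rw [extraction_adj] at hvw ⊢
    refine ⟨?_, fun huw => hvw.2 ?_⟩
    · rintro rfl
      exact hvw.2 huv.symm
    · exact adj_trans_of_notMem_innerHub hA (u := ⟨u, S.edge_vert huv⟩)
        (v := ⟨v, S.edge_vert huv.symm⟩) (w := ⟨w, S.edge_vert huw.symm⟩)
        (fun h => hu ⟨_, h, rfl⟩) huv huw (fun h => hvw.1 (congrArg Subtype.val h))
  rw [extraction_adj, not_and_not_right] at h
  by_cases huv : u = v
  · rw [huv]
  · exact ⟨key v u hv (h huv).symm, key u v hu (h huv)⟩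

theorem extraction_twin_of_complete (hS : S.coe = ⊤) {u v : Fin m}
    (h : ¬ (extraction S).Adj u v) (w : Fin m) :
    (extraction S).Adj u w ↔ (extraction S).Adj v w := by
  have hadj : ∀ u v : Fin m, u ∈ S.verts → v ∈ S.verts → u ≠ v → S.Adj u v := by
    intro u v hu hv huv
    have : S.coe.Adj ⟨u, hu⟩ ⟨v, hv⟩ := by
      rw [hS]
      exact fun h => huv (congrArg Subtype.val h)
    exact this
  have hiff : ∀ u ∈ S.verts, ((extraction S).Adj u w ↔ w ∉ S.verts) := by
    intro u hu
    rw [extraction_adj]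
    exact ⟨fun h hw => h.2 (hadj u w hu hw h.1),
      fun hw => ⟨fun h => hw (h ▸ hu), fun h => hw (S.edge_vert h.symm)⟩⟩
  rw [extraction_adj, not_and_not_right] at h
  by_cases huv : u = v
  · rw [huv]
  · rw [hiff u (S.edge_vert (h huv)), hiff v (S.edge_vert (h huv).symm)]

end Hub

section MonotoneSets

variable {m n : ℕ} {G : SimpleGraph (Fin m)} {Γ : Set (Fin m → EuclideanSpace ℝ (Fin n))}

/-- Permuting the coordinates of finitely many points of `Γ` does not increase the total surplus. -/
def IsSurplusMonotone (G : SimpleGraph (Fin m)) (Γ : Set (Fin m → EuclideanSpace ℝ (Fin n))) :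
    Prop :=
  ∀ (ι : Type) [Fintype ι] [Nonempty ι] (x : ι → Fin m → EuclideanSpace ℝ (Fin n)),
    (∀ k, x k ∈ Γ) → ∀ σ : Fin m → Equiv.Perm ι,
      ∑ k, surplus G (fun j => x (σ j k) j) ≤ ∑ k, surplus G (x k)

theorem IsSurplusMonotone.sum_inner_nonneg (hΓ : IsSurplusMonotone G Γ)
    {x y : Fin m → EuclideanSpace ℝ (Fin n)} (hx : x ∈ Γ) (hy : y ∈ Γ) (I : Finset (Fin m))
    (hI : ∀ v ∈ I, ∀ w ∈ I, ¬ G.Adj v w) :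
    0 ≤ ∑ i ∈ I, inner ℝ ((x - y) i) (neighborSum G (x - y) i) := by
  have h := hΓ Bool (fun k => cond k x y) (by rintro (_ | _) <;> assumption)
    (fun j => if j ∈ I then Equiv.boolNot else Equiv.refl _)
  let u : Fin m → EuclideanSpace ℝ (Fin n) := fun j => if j ∈ I then x j - y j else 0
  have hu : ∀ v ∉ I, u v = 0 := fun v hv => if_neg hv
  have hu' : ∀ v ∉ I, (-u) v = 0 := fun v hv => by simp [hu v hv]
  have e1 : (fun j => (cond ((if j ∈ I then Equiv.boolNot else Equiv.refl _) true) x y) j) =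
      x + -u := by
    funext j
    by_cases hj : j ∈ I <;> simp [hj, u]
  have e2 : (fun j => (cond ((if j ∈ I then Equiv.boolNot else Equiv.refl _) false) x y) j) =
      y + u := by
    funext j
    by_cases hj : j ∈ I <;> simp [hj, u]
  rw [Fintype.sum_bool, Fintype.sum_bool, e1, e2, surplus_add_of_independent G x _ I hI hu',
    surplus_add_of_independent G y _ I hI hu] at h
  have e3 : ∑ i ∈ I, inner ℝ ((x - y) i) (neighborSum G (x - y) i) =
      -(∑ i ∈ I, inner ℝ ((-u) i) (neighborSum G x i)) -
        ∑ i ∈ I, inner ℝ (u i) (neighborSum G y i) := by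
    rw [← Finset.sum_neg_distrib, ← Finset.sum_sub_distrib]
    refine Finset.sum_congr rfl fun i hi => ?_
    simp only [u, hi, Pi.sub_apply, Pi.neg_apply, if_true, neighborSum_sub, inner_sub_right,
      inner_neg_left, neg_neg]
  simp only [cond_true, cond_false] at h
  linarith

theorem IsSurplusMonotone.exists_null_of_ne (hΓ : IsSurplusMonotone G Γ) {R : ℝ}
    (hR : ∀ x ∈ Γ, ∀ i, ‖x i‖ ≤ R) {i v : Fin m} (hiv : i ≠ v) :
    ∃ N : Set (EuclideanSpace ℝ (Fin n)), MeasurableSet N ∧ volume N = 0 ∧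
      ∀ x ∈ Γ, ∀ y ∈ Γ, x v ∉ N → (x v = y v → neighborSum G x v = neighborSum G y v) ∧
        (G.Adj i v → neighborSum G x i = neighborSum G y i → x i = y i) := by
  classical
  let M : Set (EuclideanSpace ℝ (Fin n) × EuclideanSpace ℝ (Fin n)) :=
    {z | ∃ x ∈ Γ, ∃ y ∈ Γ, neighborSum G x i = neighborSum G y i ∧
      z = (x v, neighborSum G (Function.update x i (y i)) v)}
  have hMR : ∀ z ∈ M, ‖z.2‖ ≤ (Fintype.card (Fin m) * R).toNNReal := by
    rintro _ ⟨x, hx, y, hy, -, rfl⟩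
    refine (norm_neighborSum_le G _ v (R := R) fun j => ?_).trans (Real.le_coe_toNNReal _)
    by_cases hj : j = i
    · subst hj; simpa using hR y hy j
    · simpa [hj] using hR x hx j
  have hcyc : ∀ (N : ℕ) (z : Fin (N + 1) → _), (∀ k, z k ∈ M) →
      ∑ k, inner ℝ (z k).2 ((z (k + 1)).1 - (z k).1) ≤ 0 := by
    intro N z hz
    choose x hx y hy hs hzxy using hz
    have h := hΓ (Fin (N + 1) ⊕ Fin (N + 1)) (Sum.elim x y)
      (by rintro (k | k); exacts [hx k, hy k])
      (fun j => if j = v then Equiv.sumCongr (finRotate (N + 1)) (Equiv.refl _) else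
        if j = i then Equiv.sumComm _ _ else Equiv.refl _)
    rw [Fintype.sum_sum_type, Fintype.sum_sum_type, ← Finset.sum_add_distrib,
      ← Finset.sum_add_distrib] at h
    rw [← sub_nonpos, ← Finset.sum_sub_distrib] at h
    refine le_of_eq_of_le (Finset.sum_congr rfl fun k _ => ?_) h
    have e1 : (fun j => Sum.elim x y ((if j = v then
        Equiv.sumCongr (finRotate (N + 1)) (Equiv.refl _) else
        if j = i then Equiv.sumComm _ _ else Equiv.refl _) (Sum.inl k)) j) =
        Function.update (Function.update (x k) i (y k i)) v (x (k + 1) v) := by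
      funext j
      by_cases hjv : j = v
      · subst hjv; simp
      · by_cases hji : j = i
        · subst hji; simp [hjv]
        · simp [hjv, hji]
    have e2 : (fun j => Sum.elim x y ((if j = v then
        Equiv.sumCongr (finRotate (N + 1)) (Equiv.refl _) else
        if j = i then Equiv.sumComm _ _ else Equiv.refl _) (Sum.inr k)) j) =
        Function.update (y k) i (x k i) := by
      funext j
      by_cases hjv : j = v
      · subst hjv; simp [hiv.symm]
      · by_cases hji : j = i
        · subst hji; simp [hjv]
        · simp [hjv, hji]
    rw [e1, e2, surplus_update, surplus_update, surplus_update, hzxy k, hzxy (k + 1),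
      Function.update_of_ne hiv.symm, hs k]
    simp only [Sum.elim_inl, Sum.elim_inr]
    rw [real_inner_comm, ← neg_sub (y k i) (x k i), inner_neg_left]
    ring
  obtain ⟨N, hN, hN0, huniq⟩ := exists_null_unique_of_cyclicallyMonotone volume M _ hMR hcyc
  have hself : ∀ x ∈ Γ, (x v, neighborSum G x v) ∈ M := fun x hx =>
    ⟨x, hx, x, hx, rfl, by rw [Function.update_eq_self]⟩
  refine ⟨N, hN, hN0, fun x hx y hy hxN => ⟨fun hxy => ?_, fun hadj hs => ?_⟩⟩
  · exact huniq _ hxN _ _ (hself x hx) (hxy ▸ hself y hy)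
  · have h := huniq _ hxN _ _ (hself x hx) ⟨x, hx, y, hy, hs, rfl⟩
    have hupd : Function.update x i (y i) = x + Pi.single i (y i - x i) := by
      ext1 j
      by_cases hj : j = i
      · subst hj; simp
      · simp [hj]
    rw [hupd, neighborSum_add, neighborSum_single, if_pos hadj.symm] at h
    exact (sub_eq_zero.1 (left_eq_add.1 h)).symm

theorem IsSurplusMonotone.exists_null (hΓ : IsSurplusMonotone G Γ) {R : ℝ}
    (hR : ∀ x ∈ Γ, ∀ i, ‖x i‖ ≤ R) (v : Fin m) :
    ∃ N : Set (EuclideanSpace ℝ (Fin n)), MeasurableSet N ∧ volume N = 0 ∧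
      ∀ x ∈ Γ, ∀ y ∈ Γ, x v ∉ N → (x v = y v → neighborSum G x v = neighborSum G y v) ∧
        ∀ i, G.Adj i v → neighborSum G x i = neighborSum G y i → x i = y i := by
  choose N hN hN0 h using fun i : {i : Fin m // i ≠ v} => hΓ.exists_null_of_ne hR i.2
  refine ⟨⋃ i, N i, MeasurableSet.iUnion hN, measure_iUnion_null hN0,
    fun x hx y hy hxN => ⟨fun hxy => ?_, fun i hi => ?_⟩⟩
  · by_cases hv : ∃ i, i ≠ v
    · obtain ⟨i, hi⟩ := hv
      exact (h ⟨i, hi⟩ x hx y hy fun hmem => hxN (Set.mem_iUnion_of_mem _ hmem)).1 hxy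
    · push Not at hv
      have : ∀ w, ¬ G.Adj v w := fun w hw => hw.ne (hv w).symm
      simp [neighborSum, this]
  · exact (h ⟨i, hi.ne⟩ x hx y hy fun hmem => hxN (Set.mem_iUnion_of_mem _ hmem)).2 hi

end MonotoneSets

section Transport

variable {m n : ℕ} {X : Fin m → Set (EuclideanSpace ℝ (Fin n))}

/-- A plan concentrated on a Borel set with injective projection to the first factor is induced by
a map (Lusin–Souslin). -/
theorem IsPlan.isInducedByMap_of_injOn [NeZero m] (hX : ∀ i, MeasurableSet (X i))
    {μ : ∀ i, Measure (X i)} {γ : Measure (∀ i, X i)} (hγ : IsPlan μ γ) {s : Set (∀ i, X i)}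
    (hs : MeasurableSet s) (hsγ : ∀ᵐ x ∂γ, x ∈ s) (hinj : s.InjOn fun x => x 0) :
    IsInducedByMap μ γ := by
  classical
  have := hγ.prob
  have hne : Nonempty (∀ i, X i) := nonempty_of_isProbabilityMeasure γ
  have hst : ∀ i, StandardBorelSpace (X i) := fun i => (hX i).standardBorel
  have hss : StandardBorelSpace s := hs.standardBorel
  have hfm : Measurable fun x : s => (x : ∀ i, X i) 0 :=
    (measurable_pi_apply 0).comp measurable_subtype_coe
  have hemb : MeasurableEmbedding fun x : s => (x : ∀ i, X i) 0 :=
    hfm.measurableEmbedding fun x y hxy => Subtype.ext (hinj x.2 y.2 hxy)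
  obtain ⟨T, hT, hTs⟩ := hemb.exists_measurable_extend measurable_subtype_coe fun _ => hne
  let T' : ∀ i, X 0 → X i := Function.update (fun i x => T x i) 0 id
  have hT'm : ∀ i, Measurable (T' i) := by
    intro i
    by_cases hi : i = 0
    · subst hi
      simpa [T'] using measurable_id
    · simpa [T', hi] using measurable_pi_iff.1 hT i
  refine ⟨T', hT'm, Function.update_self _ _ _, ?_⟩
  have hTm : Measurable fun (x : X 0) i => T' i x := measurable_pi_lambda _ hT'm
  rw [← hγ.marginal 0, Measure.map_map hTm (measurable_pi_apply 0)]
  conv_lhs => rw [← Measure.map_id (μ := γ)]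
  refine Measure.map_congr ?_
  filter_upwards [hsγ] with x hx
  funext i
  by_cases hi : i = 0
  · subst hi; simp [T']
  · simpa [T', hi] using (congrFun (congrFun hTs ⟨x, hx⟩) i).symm

theorem IsKantorovichSolution.isSurplusMonotone_support {G : SimpleGraph (Fin m)}
    (hXb : ∀ i, Bornology.IsBounded (X i)) {μ : ∀ i, Measure (X i)} {γ : Measure (∀ i, X i)}
    (hγ : IsKantorovichSolution G μ γ) :
    IsSurplusMonotone G ((fun (x : ∀ i, X i) i => (x i : EuclideanSpace ℝ (Fin n))) '' γ.support) ∧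
    ∃ R, ∀ (x : ∀ i, X i) i, ‖(x i : EuclideanSpace ℝ (Fin n))‖ ≤ R := by
  have := hγ.1.prob
  obtain ⟨R, hR⟩ : ∃ R, ∀ i, ∀ y ∈ X i, ‖y‖ ≤ R := by
    choose R hR using fun i => (hXb i).exists_norm_le
    refine ⟨∑ i, |R i|, fun i y hy => (hR i y hy).trans ((le_abs_self _).trans ?_)⟩
    exact Finset.single_le_sum (f := fun i => |R i|) (fun _ _ => abs_nonneg _) (Finset.mem_univ i)
  refine ⟨?_, R, fun x i => hR i _ (x i).2⟩
  obtain ⟨C, hC⟩ := exists_abs_surplus_le (n := n) G R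
  intro ι _ _ x hx σ
  choose z hz hzx using hx
  obtain rfl : (fun k i => (z k i : EuclideanSpace ℝ (Fin n))) = x := funext hzx
  refine sum_permute_le_of_mem_support γ
    (fun x => surplus G fun i => (x i : EuclideanSpace ℝ (Fin n)))
    ((continuous_surplus G).comp (by fun_prop)) C (fun x => hC _ fun i => hR i _ (x i).2)
    (fun γ' hγ' hmarg => hγ.2 γ' ⟨hγ', fun i => (hmarg i).trans (hγ.1.marginal i)⟩) z hz σ

theorem IsKantorovichSolution.isInducedByMap_of_structure [NeZero m] {G : SimpleGraph (Fin m)}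
    (hXo : ∀ i, IsOpen (X i)) (hXb : ∀ i, Bornology.IsBounded (X i))
    {μ : ∀ i, Measure (X i)} {γ : Measure (∀ i, X i)} (hγ : IsKantorovichSolution G μ γ)
    (A W P : Set (Fin m))
    (hW : ∀ w ∈ W, ∀ u, u ≠ w → G.Adj w u)
    (hA : ∀ a ∈ A, ∀ u, G.Adj a u ↔ u ∈ W)
    (htwin : ∀ u ∉ A, ∀ v ∉ A, ¬ G.Adj u v → ∀ w, G.Adj u w ↔ G.Adj v w)
    (h0A : 0 ∉ A) (h0P : 0 ∈ P) (hcover : ∀ v ≠ 0, ∃ q ∈ P, G.Adj v q)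
    (hPac : ∀ q ∈ P, IsAbsCont (μ q)) :
    IsInducedByMap μ γ := by
  have := hγ.1.prob
  obtain ⟨hΓ, R, hR⟩ := hγ.isSurplusMonotone_support hXb
  choose N hN hN0 h using hΓ.exists_null (R := R) (by rintro _ ⟨x, -, rfl⟩ i; exact hR x i)
  let c : (∀ i, X i) → Fin m → EuclideanSpace ℝ (Fin n) := fun x i => x i
  have hcm : ∀ i, Measurable fun x : ∀ i, X i => (x i : EuclideanSpace ℝ (Fin n)) := fun i =>
    measurable_subtype_coe.comp (measurable_pi_apply i)
  refine hγ.1.isInducedByMap_of_injOn (fun i => (hXo i).measurableSet)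
    (s := γ.support ∩ ⋂ q ∈ P, {x | (x q : EuclideanSpace ℝ (Fin n)) ∉ N q}) ?_ ?_ ?_
  · exact Measure.isClosed_support.measurableSet.inter <|
      MeasurableSet.biInter P.to_countable fun q _ => (hcm q (hN q)).compl
  · refine Filter.inter_mem Measure.support_mem_ae
      ((Filter.biInter_mem P.toFinite).2 fun q hq => ?_)
    have h1 := hPac q hq (hN0 q)
    rw [← hγ.1.marginal q, Measure.map_map measurable_subtype_coe (measurable_pi_apply q),
      Measure.map_apply (measurable_subtype_coe.comp (measurable_pi_apply q)) (hN q)] at h1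
    exact measure_eq_zero_iff_ae_notMem.1 h1
  · rintro x ⟨hx, hxN⟩ y ⟨hy, -⟩ (hxy : x 0 = y 0)
    have hxN' : ∀ q ∈ P, c x q ∉ N q := fun q hq => Set.mem_iInter₂.1 hxN q hq
    have hcx : c x ∈ c '' γ.support := ⟨x, hx, rfl⟩
    have hcy : c y ∈ c '' γ.support := ⟨y, hy, rfl⟩
    have h00 : (c x - c y) 0 = 0 := by simp [c, hxy]
    have hd : c x - c y = 0 := by
      refine eq_zero_of_monotone_of_determined G A W 0 (c x - c y) hW hA htwin h0A h00 ?_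
        (fun I hI => hΓ.sum_inner_nonneg hcx hcy I hI) fun v hv => ?_
      · rw [neighborSum_sub, sub_eq_zero]
        exact (h 0 _ hcx _ hcy (hxN' 0 h0P)).1 (by simp [c, hxy])
      · by_cases hv0 : v = 0
        · rw [hv0, h00]
        · obtain ⟨q, hq, hvq⟩ := hcover v hv0
          rw [neighborSum_sub, sub_eq_zero] at hv
          exact sub_eq_zero.2 ((h q _ hcx _ hcy (hxN' q hq)).2 v hvq hv)
    funext i
    exact Subtype.ext (sub_eq_zero.1 (congrFun hd i))

end Transport

end GraphTransport

theorem theorem3p1 {m n : ℕ} [NeZero m]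
    (S : (⊤ : SimpleGraph (Fin m)).Subgraph) (A : Set S.verts)
    (hA : GraphTransport.IsInnerHub S.coe A)
    (hG : (GraphTransport.extraction S).Connected)
    (X : Fin m → Set (EuclideanSpace ℝ (Fin n)))
    (hXo : ∀ i, IsOpen (X i)) (hXb : ∀ i, Bornology.IsBounded (X i))
    (μ : ∀ i, MeasureTheory.Measure (X i))
    (hμ : ∀ i, MeasureTheory.IsProbabilityMeasure (μ i))
    (hμ0 : GraphTransport.IsAbsCont (μ 0))
    (h : (0 : Fin m) ∉ S.verts ∨
      ∃ p ∈ (GraphTransport.extraction S).neighborSet 0,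
        Subtype.val '' A ⊆ (GraphTransport.extraction S).neighborSet p ∧
        GraphTransport.IsAbsCont (μ p) ∧
        (S.coe ≠ ⊤ → (0 : Fin m) ∉ Subtype.val '' A))
    (γ : MeasureTheory.Measure (∀ i, X i))
    (hγ : GraphTransport.IsKantorovichSolution (GraphTransport.extraction S) μ γ) :
    GraphTransport.IsInducedByMap μ γ := by
  open GraphTransport in
  obtain ⟨A', hA', htwin, hsub, h0⟩ : ∃ A' : Set (Fin m),
      (∀ a ∈ A', ∀ u, (extraction S).Adj a u ↔ u ∈ S.vertsᶜ) ∧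
      (∀ u ∉ A', ∀ v ∉ A', ¬ (extraction S).Adj u v →
        ∀ w, (extraction S).Adj u w ↔ (extraction S).Adj v w) ∧
      A' ⊆ Subtype.val '' A ∧ 0 ∉ A' := by
    by_cases hS : S.coe = ⊤
    · exact ⟨∅, by simp, fun u _ v _ huv => extraction_twin_of_complete hS huv, by simp, by simp⟩
    · refine ⟨Subtype.val '' A, fun a ha u => extraction_adj_innerHub_iff hA hS ha u,
        fun u hu v hv huv => extraction_twin hA hu hv huv, subset_rfl, ?_⟩
      rcases h with h | ⟨p, -, -, -, h⟩
      · rintro ⟨a, -, ha⟩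
        exact h (ha ▸ a.2)
      · exact h hS
  obtain ⟨P, h0P, hcover, hPac⟩ : ∃ P : Set (Fin m), 0 ∈ P ∧
      (∀ v ≠ 0, ∃ q ∈ P, (GraphTransport.extraction S).Adj v q) ∧
      ∀ q ∈ P, GraphTransport.IsAbsCont (μ q) := by
    rcases h with h | ⟨p, hp0, hpA, hp, -⟩
    · exact ⟨{0}, rfl, fun v hv =>
        ⟨0, rfl, (GraphTransport.extraction_adj_of_notMem S h hv).symm⟩, by simpa using hμ0⟩
    · refine ⟨{0, p}, by simp, fun v hv => ?_, by simp [hμ0, hp]⟩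
      by_cases hvA : v ∈ A'
      · exact ⟨p, by simp, (hpA (hsub hvA)).symm⟩
      · by_cases hv0 : (GraphTransport.extraction S).Adj v 0
        · exact ⟨0, by simp, hv0⟩
        · exact ⟨p, by simp, (htwin v hvA 0 h0 hv0 p).2 hp0⟩
  exact hγ.isInducedByMap_of_structure hXo hXb A' S.vertsᶜ P
    (fun w hw u hu => GraphTransport.extraction_adj_of_notMem S hw hu) hA' htwin h0 h0P hcover hPac
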